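/- Let $K$ be a field of characteristic zero and $G=(V,E)$, $E\subseteq V^2$, a finite digraph (loops allowed). A simple cycle is a closed walk of length at least $1$ with pairwise distinct vertices, up to cyclic rotation; $\mathcal P_G$ is the set of simple cycles of $G$. Hikes are the elements of the partially commutative monoid generated by $\mathcal P_G$ in which $pq=qp$ whenever $V(p)\cap V(q)=\emptyset$; $\Omega(h)$ is the number of simple cycles composing a hike $h$ and $\ell(h)$ is its length. Let $\mathcal S_G$ be the finite set of self-avoiding hikes (those visiting no vertex twice), $K\langle\mathcal S_G\rangle$ the vector space with basis $\mathcal S_G$, with the product $h*h'=hh'$ if $V(h)\cap V(h')=\emptyset$ and $h*h'=0$ otherwise, and $K\langle\mathcal P_G\rangle\subseteq K\langle\mathcal S_G\rangle$ the span of the simple cycles. A Lie idempotent is a family $\imath=(\imath_n)_{n\ge 0}$, $\imath_n\in K[\mathfrak S_n]$, such that for every $K$-vector space $W$ the operator $$v_1\otimes\cdots\otimes v_n\longmapsto\sum_{\sigma\in\mathfrak S_n}\imath_n(\sigma)\,v_{\sigma(1)}\otimes\cdots\otimes v_{\sigma(n)}$$ on the tensor algebra $T(W)$ is a projection onto the free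 Lie algebra on $W$, i.e. the Lie subalgebra of $T(W)$ generated by $W$. **Theorem.** Let $\imath$ be a Lie idempotent. There is a unique linear endomorphism of $K\langle\mathcal S_G\rangle$, again denoted $\imath$, that is induced by the action of $\imath$ on $T(K\langle\mathcal P_G\rangle)$ through the algebra homomorphism $T(K\langle\mathcal P_G\rangle)\to K\langle\mathcal S_G\rangle$, $p_1\otimes\cdots\otimes p_n\mapsto p_1*\cdots*p_n$. It satisfies: 1. $\imath(h)\in\mathcal P_G\cup\{0\}$ for every $h\in\mathcal S_G$; 2. $\imath$ is a linear projection of $K\langle\mathcal S_G\rangle$ onto $K\langle\mathcal P_G\rangle$; 3. $\imath\big(\sum_{h\in\mathcal S_G}h\big)=\sum_{p\in\mathcal P_G}p$; consequently, for every $n$, the number of simple cycles of length $n$ is the sum of the coefficients of the hikes of length $n$ in $\imath\big(\sum_{h\in\mathcal S_G}h\big)$. Properties 1--3 also hold for the Eulerian idempotent $\log_\star(\mathrm{id})=\sum_{k\ge1}\frac{(-1)^{k-1}}{k}(\mathrm{id}-\eta\epsilon)^{\star k}$ and for the Dynkin idempotent $S\star E$ of $K\langle\mathcal S_G\rangle$.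 Here $\eta\epsilon(h)=1$ if $h=1$ and $0$ otherwise, $S(h)=(-1)^{\Omega(h)}h$, $E(h)=\Omega(h)h$, and $f\star g=m\circ(f\otimes g)\circ\Delta$ with $m$ the product $*$ and $\Delta(h)=\sum d\otimes d'$, summed over the pairs $(d,d')$ of vertex-disjoint self-avoiding hikes with $dd'=h$. -/

import Mathlib

open scoped TensorProduct

universe u v

/-! ### Simple cycles, hikes and self-avoiding hikes of a digraph -/

/-- A simple cycle of the digraph `G` (loops and backtracks included): a nonempty cyclic sequence of
pairwise distinct vertices, each vertex being joined by an edge to the next one (cyclically).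
Cyclic rotations of the same closed simple walk are identified. -/
def SimpleCycle {V : Type v} (G : Digraph V) : Type v :=
  {c : Cycle V // c ≠ Cycle.nil ∧ c.Nodup ∧ c.Chain G.Adj}

namespace SimpleCycle

variable {V : Type v} {G : Digraph V}

/-- The multiset of vertices of a simple cycle. -/
def verts (p : SimpleCycle G) : Multiset V := p.1.toMultiset

/-- The length of a simple cycle (its number of edges, or of vertices). -/
def length (p : SimpleCycle G) : ℕ := p.1.length

theorem nodup_verts (p : SimpleCycle G) : p.verts.Nodup := by
  obtain ⟨c, _, h, _⟩ := p
  induction c using Quotient.inductionOn' with | _ l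
  exact h

theorem verts_pos (p : SimpleCycle G) : 0 < p.verts.card := by
  obtain ⟨c, h, _, _⟩ := p
  induction c using Quotient.inductionOn' with | _ l
  cases l with
  | nil => exact absurd rfl h
  | cons a l => exact Nat.succ_pos _

instance [Finite V] : Finite (SimpleCycle G) := by
  have := Fintype.ofFinite V
  classical
  exact Finite.of_injective
    (fun p : SimpleCycle G => (⟨p.1, p.2.2.1⟩ : {c : Cycle V // c.Nodup}))
    (fun p q h => Subtype.ext (by simpa using h))

noncomputable instance [Finite V] : Fintype (SimpleCycle G) := Fintype.ofFinite _

end SimpleCycle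

/-- The relations defining hikes: two vertex-disjoint simple cycles commute. -/
inductive HikeRel {V : Type v} (G : Digraph V) :
    FreeMonoid (SimpleCycle G) → FreeMonoid (SimpleCycle G) → Prop
  | comm (p q : SimpleCycle G) (h : Disjoint p.verts q.verts) :
      HikeRel G (FreeMonoid.of p * FreeMonoid.of q) (FreeMonoid.of q * FreeMonoid.of p)

/-- The partially commutative monoid of hikes on `G`: words in the simple cycles of `G`, up to
permutation of successive vertex-disjoint simple cycles. -/
abbrev Hike {V : Type v} (G : Digraph V) : Type v := PresentedMonoid (HikeRel G)

namespace Hike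

variable {V : Type v} {G : Digraph V}

/-- A simple cycle, regarded as a hike. -/
def ofCycle (p : SimpleCycle G) : Hike G := PresentedMonoid.of (HikeRel G) p

/-- The vertices visited by a hike, with multiplicity, as a monoid homomorphism. -/
def vertsHom (G : Digraph V) : Hike G →* Multiplicative (Multiset V) :=
  PresentedMonoid.lift (fun p => Multiplicative.ofAdd p.verts) (by
    rintro _ _ ⟨p, q, _⟩
    simp [mul_comm])

/-- The multiset of the vertices visited by a hike. -/
def verts (h : Hike G) : Multiset V := (vertsHom G h).toAdd

/-- The number of simple cycles composing a hike, as a monoid homomorphism. -/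
def omegaHom (G : Digraph V) : Hike G →* Multiplicative ℕ :=
  PresentedMonoid.lift (fun _ => Multiplicative.ofAdd 1) (by
    rintro _ _ ⟨p, q, _⟩
    simp)

/-- `Ω(h)`: the number of simple cycles composing `h`, with multiplicity. -/
def omega (h : Hike G) : ℕ := (omegaHom G h).toAdd

/-- The length `ℓ(h)` of a hike. As a simple cycle has as many edges as vertices, it is the number
of vertices visited, with multiplicity. -/
def length (h : Hike G) : ℕ := h.verts.card

/-- A hike is self-avoiding if it does not visit the same vertex twice. -/
def IsSelfAvoiding (h : Hike G) : Prop := h.verts.Nodup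

@[simp] theorem verts_one : (1 : Hike G).verts = 0 := by simp [verts]

@[simp] theorem verts_mul (h k : Hike G) : (h * k).verts = h.verts + k.verts := by simp [verts]

@[simp] theorem verts_ofCycle (p : SimpleCycle G) : (ofCycle p).verts = p.verts := rfl

theorem length_le_card_verts (l : List (SimpleCycle G)) :
    l.length ≤ (verts (PresentedMonoid.mk (HikeRel G) (FreeMonoid.ofList l))).card := by
  induction l with
  | nil => simp
  | cons p l ih =>
    have : PresentedMonoid.mk (HikeRel G) (FreeMonoid.ofList (p :: l)) =
      ofCycle p * PresentedMonoid.mk (HikeRel G) (FreeMonoid.ofList l) := by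
      rw [FreeMonoid.ofList_cons, map_mul]; rfl
    rw [this, verts_mul, Multiset.card_add, verts_ofCycle, List.length_cons]
    have := p.verts_pos
    omega

end Hike

/-- The set `S_G` of self-avoiding hikes on `G`. -/
def SelfAvoidingHike {V : Type v} (G : Digraph V) : Type v := {h : Hike G // h.IsSelfAvoiding}

namespace SelfAvoidingHike

variable {V : Type v} {G : Digraph V}

/-- The empty hike. -/
def one : SelfAvoidingHike G := ⟨1, by simp [Hike.IsSelfAvoiding]⟩

/-- A simple cycle, regarded as a self-avoiding hike. -/
def ofCycle (p : SimpleCycle G) : SelfAvoidingHike G := ⟨Hike.ofCycle p, p.nodup_verts⟩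

/-- Two hikes are vertex-disjoint. -/
def VDisjoint (h k : SelfAvoidingHike G) : Prop := Disjoint h.1.verts k.1.verts

/-- The concatenation of two vertex-disjoint self-avoiding hikes. -/
def mul (h k : SelfAvoidingHike G) (hk : h.VDisjoint k) : SelfAvoidingHike G :=
  ⟨h.1 * k.1, by
    rw [Hike.IsSelfAvoiding, Hike.verts_mul]
    exact Multiset.nodup_add.2 ⟨h.2, k.2, hk⟩⟩

instance [Finite V] : Finite (SelfAvoidingHike G) := by
  have := Fintype.ofFinite V
  have hfin : Finite {l : List (SimpleCycle G) // l.length ≤ Fintype.card V} :=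
    List.finite_length_le _ _
  have key : ∀ h : SelfAvoidingHike G, ∃ l : {l : List (SimpleCycle G) // l.length ≤ Fintype.card V},
      PresentedMonoid.mk (HikeRel G) (FreeMonoid.ofList l.1) = h.1 := by
    rintro ⟨h, hh⟩
    induction h using PresentedMonoid.inductionOn with | _ w
    refine ⟨⟨FreeMonoid.toList w, (Hike.length_le_card_verts _).trans ?_⟩, rfl⟩
    classical
    have := (Multiset.toFinset_card_of_nodup hh)
    exact this ▸ Finset.card_le_univ _
  choose F hF using key
  exact Finite.of_injective F (fun a b hab => Subtype.ext (by rw [← hF a, ← hF b, hab]))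

noncomputable instance [Finite V] : Fintype (SelfAvoidingHike G) := Fintype.ofFinite _

end SelfAvoidingHike

/-! ### The algebra `K⟨S_G⟩` -/

/-- `K⟨S_G⟩`: the finite `K`-linear combinations of self-avoiding hikes on `G`. -/
def HikeAlgebra (K : Type u) [Field K] {V : Type v} (G : Digraph V) : Type (max u v) :=
  SelfAvoidingHike G →₀ K

namespace HikeAlgebra

variable (K : Type u) [Field K] {V : Type v} (G : Digraph V)

noncomputable instance : AddCommGroup (HikeAlgebra K G) :=
  inferInstanceAs (AddCommGroup (SelfAvoidingHike G →₀ K))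

noncomputable instance : Module K (HikeAlgebra K G) :=
  inferInstanceAs (Module K (SelfAvoidingHike G →₀ K))

/-- The self-avoiding hikes form a basis of `K⟨S_G⟩`. -/
noncomputable def basis : Module.Basis (SelfAvoidingHike G) K (HikeAlgebra K G) :=
  ⟨LinearEquiv.refl K (SelfAvoidingHike G →₀ K)⟩

open scoped Classical in
/-- The product `h * k` of basis elements: the concatenation `hk` if `h` and `k` are
vertex-disjoint, and `0` otherwise. -/
noncomputable def basisMul (h k : SelfAvoidingHike G) : HikeAlgebra K G :=
  if hk : h.VDisjoint k then basis K G (h.mul k hk) else 0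

/-- The bilinear extension of `basisMul`. -/
noncomputable def mulLin : HikeAlgebra K G →ₗ[K] HikeAlgebra K G →ₗ[K] HikeAlgebra K G :=
  (basis K G).constr K fun h => (basis K G).constr K fun k => basisMul K G h k

noncomputable instance : Mul (HikeAlgebra K G) := ⟨fun a b => mulLin K G a b⟩

noncomputable instance : One (HikeAlgebra K G) := ⟨basis K G SelfAvoidingHike.one⟩

theorem mul_def (a b : HikeAlgebra K G) : a * b = mulLin K G a b := rfl

theorem one_def : (1 : HikeAlgebra K G) = basis K G SelfAvoidingHike.one := rfl

theorem basis_mul_basis (h k : SelfAvoidingHike G) :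
    basis K G h * basis K G k = basisMul K G h k := by
  simp [mul_def, mulLin]

theorem mulLin_one_left : mulLin K G 1 = LinearMap.id := by
  refine (basis K G).ext fun k => ?_
  rw [← mul_def, one_def, basis_mul_basis, basisMul, dif_pos]
  · exact congrArg _ (Subtype.ext (one_mul _))
  · simp [SelfAvoidingHike.VDisjoint, SelfAvoidingHike.one]

theorem mulLin_one_right : (mulLin K G).flip 1 = LinearMap.id := by
  refine (basis K G).ext fun k => ?_
  rw [LinearMap.flip_apply, ← mul_def, one_def, basis_mul_basis, basisMul, dif_pos]
  · exact congrArg _ (Subtype.ext (mul_one _))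
  · simpa [SelfAvoidingHike.VDisjoint, SelfAvoidingHike.one] using
      (disjoint_bot_right : Disjoint k.1.verts ⊥)

theorem basis_mul_assoc (h k l : SelfAvoidingHike G) :
    basis K G h * basis K G k * basis K G l = basis K G h * (basis K G k * basis K G l) := by
  have hz : ∀ a : HikeAlgebra K G, 0 * a = 0 := fun a => by simp [mul_def]
  have hz' : ∀ a : HikeAlgebra K G, a * 0 = 0 := fun a => by simp [mul_def]
  rw [basis_mul_basis, basis_mul_basis, basisMul, basisMul]
  by_cases hk : h.VDisjoint k <;> by_cases kl : k.VDisjoint l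
  · rw [dif_pos hk, dif_pos kl, basis_mul_basis, basis_mul_basis, basisMul, basisMul]
    by_cases hl : h.VDisjoint l
    · rw [dif_pos, dif_pos]
      · exact congrArg _ (Subtype.ext (mul_assoc _ _ _))
      · simpa [SelfAvoidingHike.VDisjoint, SelfAvoidingHike.mul] using ⟨hk, hl⟩
      · simpa [SelfAvoidingHike.VDisjoint, SelfAvoidingHike.mul] using ⟨hl, kl⟩
    · rw [dif_neg, dif_neg]
      · exact fun H => hl (by
          simp only [SelfAvoidingHike.VDisjoint, SelfAvoidingHike.mul, Hike.verts_mul,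
            Multiset.disjoint_add_right] at H
          exact H.2)
      · exact fun H => hl (by
          simp only [SelfAvoidingHike.VDisjoint, SelfAvoidingHike.mul, Hike.verts_mul,
            Multiset.disjoint_add_left] at H
          exact H.1)
  · rw [dif_pos hk, dif_neg kl, basis_mul_basis, hz', basisMul, dif_neg]
    exact fun H => kl (by
      simp only [SelfAvoidingHike.VDisjoint, SelfAvoidingHike.mul, Hike.verts_mul,
        Multiset.disjoint_add_left] at H
      exact H.2)
  · rw [dif_neg hk, dif_pos kl, basis_mul_basis, hz, basisMul, dif_neg]
    exact fun H => hk (by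
      simp only [SelfAvoidingHike.VDisjoint, SelfAvoidingHike.mul, Hike.verts_mul,
        Multiset.disjoint_add_right] at H
      exact H.1)
  · rw [dif_neg hk, dif_neg kl, hz, hz']

theorem mul_assoc_aux (a b c : HikeAlgebra K G) : a * b * c = a * (b * c) := by
  have h3 : ∀ h k, mulLin K G (basis K G h * basis K G k) =
      mulLin K G (basis K G h) ∘ₗ mulLin K G (basis K G k) := fun h k =>
    (basis K G).ext fun l => basis_mul_assoc K G h k l
  have h2 : ∀ h c, (mulLin K G).flip c ∘ₗ mulLin K G (basis K G h) =
      mulLin K G (basis K G h) ∘ₗ (mulLin K G).flip c := fun h c =>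
    (basis K G).ext fun k => LinearMap.congr_fun (h3 h k) c
  have h1 : (mulLin K G).flip c ∘ₗ (mulLin K G).flip b = (mulLin K G).flip (b * c) :=
    (basis K G).ext fun h => LinearMap.congr_fun (h2 h c) b
  exact LinearMap.congr_fun h1 a

noncomputable instance : Ring (HikeAlgebra K G) :=
  { (inferInstance : AddCommGroup (HikeAlgebra K G)),
    (inferInstance : Mul (HikeAlgebra K G)),
    (inferInstance : One (HikeAlgebra K G)) with
    left_distrib := fun a b c => (mulLin K G a).map_add b c
    right_distrib := fun a b c => (mulLin K G).map_add₂ a b c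
    zero_mul := fun a => (mulLin K G).map_zero₂ a
    mul_zero := fun a => (mulLin K G a).map_zero
    mul_assoc := mul_assoc_aux K G
    one_mul := fun a => LinearMap.congr_fun (mulLin_one_left K G) a
    mul_one := fun a => LinearMap.congr_fun (mulLin_one_right K G) a }

noncomputable instance : Algebra K (HikeAlgebra K G) :=
  Algebra.ofModule (fun r a b => (mulLin K G).map_smul₂ r a b)
    (fun r a b => (mulLin K G a).map_smul r b)

/-- A simple cycle, as an element of `K⟨S_G⟩`. -/
noncomputable def prime (p : SimpleCycle G) : HikeAlgebra K G :=
  basis K G (SelfAvoidingHike.ofCycle p)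

/-- `K⟨P_G⟩` inside `K⟨S_G⟩`: the linear span of the simple cycles. -/
noncomputable def primeSpan : Submodule K (HikeAlgebra K G) := Submodule.span K (Set.range (prime K G))

/-- The algebra homomorphism from the tensor algebra of `K⟨P_G⟩` to `K⟨S_G⟩` that sends
`p₁ ⊗ ⋯ ⊗ pₙ` to `p₁ * ⋯ * pₙ`, for simple cycles `p₁, …, pₙ`. -/
noncomputable def ofTensor : TensorAlgebra K (SimpleCycle G →₀ K) →ₐ[K] HikeAlgebra K G :=
  TensorAlgebra.lift K (Finsupp.linearCombination K (prime K G))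

/-! ### The comultiplication, and the Eulerian and Dynkin endomorphisms of `K⟨S_G⟩` -/

section Convolution

variable [Finite V]

open scoped Classical in
/-- The comultiplication `Δ(h) = ∑ d ⊗ h/d`, over the divisors `d` of `h` such that `d` and `h/d`
are vertex-disjoint. -/
noncomputable def comul : HikeAlgebra K G →ₗ[K] HikeAlgebra K G ⊗[K] HikeAlgebra K G :=
  (basis K G).constr K fun h =>
    ∑ de : SelfAvoidingHike G × SelfAvoidingHike G with
      de.1.VDisjoint de.2 ∧ de.1.1 * de.2.1 = h.1, basis K G de.1 ⊗ₜ[K] basis K G de.2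

open scoped Classical in
/-- The projection `η ∘ ε` (unit after counit): `1 ↦ 1` and `h ↦ 0` for every hike `h ≠ 1`. -/
noncomputable def unitCounit : HikeAlgebra K G →ₗ[K] HikeAlgebra K G :=
  (basis K G).constr K fun h => if h.1 = 1 then 1 else 0

variable {K G} in
/-- The convolution product of two endomorphisms of `K⟨S_G⟩`. -/
noncomputable def convolve (f g : HikeAlgebra K G →ₗ[K] HikeAlgebra K G) :
    HikeAlgebra K G →ₗ[K] HikeAlgebra K G :=
  LinearMap.mul' K (HikeAlgebra K G) ∘ₗ TensorProduct.map f g ∘ₗ comul K G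

variable {K G} in
/-- Convolution powers. -/
noncomputable def convPow (f : HikeAlgebra K G →ₗ[K] HikeAlgebra K G) :
    ℕ → (HikeAlgebra K G →ₗ[K] HikeAlgebra K G)
  | 0 => unitCounit K G
  | n + 1 => convolve (convPow f n) f

/-- The Eulerian idempotent: the convolution logarithm of the identity,
`∑_{k ≥ 1} ((-1) ^ (k - 1) / k) (id - η ∘ ε)^{⋆k}`, a sum with finitely many nonzero terms at
every hike. -/
noncomputable def eulerian : HikeAlgebra K G →ₗ[K] HikeAlgebra K G :=
  (basis K G).constr K fun h =>
    ∑ᶠ k : ℕ, ((-1 : K) ^ k / (k + 1 : K)) •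
      convPow (LinearMap.id - unitCounit K G) (k + 1) (basis K G h)

/-- The antipode `S(h) = (-1) ^ Ω(h) h`. -/
noncomputable def antipode : HikeAlgebra K G →ₗ[K] HikeAlgebra K G :=
  (basis K G).constr K fun h => (-1 : K) ^ h.1.omega • basis K G h

/-- The grading operator `E(h) = Ω(h) h`. -/
noncomputable def grading : HikeAlgebra K G →ₗ[K] HikeAlgebra K G :=
  (basis K G).constr K fun h => (h.1.omega : K) • basis K G h

/-- The Dynkin idempotent: the convolution product `S ⋆ E`. -/
noncomputable def dynkin : HikeAlgebra K G →ₗ[K] HikeAlgebra K G :=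
  convolve (antipode K G) (grading K G)

variable {K G} in
open scoped Classical in
/-- The endomorphism `f` of `K⟨S_G⟩` maps `S_G` to `P_G ∪ {0}`, is a linear projection of `K⟨S_G⟩`
onto `K⟨P_G⟩`, and thereby counts the simple cycles. -/
structure ProjectsOntoPrimes (f : HikeAlgebra K G →ₗ[K] HikeAlgebra K G) : Prop where
  /-- Every self-avoiding hike is sent to a simple cycle or to `0`. -/
  map_hike : ∀ h : SelfAvoidingHike G,
    f (basis K G h) = 0 ∨ ∃ p : SimpleCycle G, f (basis K G h) = prime K G p
  /-- `f` takes its values in `K⟨P_G⟩` and is the identity on `K⟨P_G⟩`. -/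
  isProj : LinearMap.IsProj (primeSpan K G) f
  /-- `f (∑_{h ∈ S_G} h) = ∑_{p ∈ P_G} p`. -/
  map_sum : f (∑ h : SelfAvoidingHike G, basis K G h) = ∑ p : SimpleCycle G, prime K G p
  /-- The number of simple cycles of length `n` is the sum of the coefficients of the hikes of
  length `n` in `f (∑_{h ∈ S_G} h)`. -/
  count : ∀ n : ℕ, (Fintype.card {p : SimpleCycle G // p.length = n} : K) =
    ∑ h : SelfAvoidingHike G with h.1.length = n,
      (basis K G).repr (f (∑ k : SelfAvoidingHike G, basis K G k)) h

end Convolution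

end HikeAlgebra

/-! ### Lie idempotents -/

section LieIdempotent

attribute [local instance] LieRing.ofAssociativeRing

variable {K : Type u} [Field K]

/-- A symmetrizer: an element `a n` of the group algebra `K[𝔖ₙ]` for every `n`. -/
abbrev Symmetrizer (K : Type u) [Field K] : Type u :=
  ∀ n : ℕ, MonoidAlgebra K (Equiv.Perm (Fin n))

/-- The action of a symmetrizer on the tensor algebra by permutation of places:
`v₁ ⊗ ⋯ ⊗ vₙ ↦ ∑_σ a n σ • v_{σ 1} ⊗ ⋯ ⊗ v_{σ n}`. -/
noncomputable def Symmetrizer.act (a : Symmetrizer K) (W : Type v) [AddCommGroup W] [Module K W] :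
    TensorAlgebra K W →ₗ[K] TensorAlgebra K W :=
  DirectSum.toModule K ℕ (TensorAlgebra K W) (fun n =>
    ∑ σ : Equiv.Perm (Fin n), (a n).coeff σ •
      (TensorPower.toTensorAlgebra ∘ₗ
        (PiTensorProduct.reindex K (fun _ : Fin n => W) σ.symm).toLinearMap)) ∘ₗ
  (TensorAlgebra.equivDirectSum (R := K) (M := W)).toLinearMap

theorem Symmetrizer.act_tprod (a : Symmetrizer K) (W : Type v) [AddCommGroup W] [Module K W]
    (n : ℕ) (w : Fin n → W) :
    a.act W (TensorAlgebra.tprod K W n w) =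
      ∑ σ : Equiv.Perm (Fin n), (a n).coeff σ • TensorAlgebra.tprod K W n (fun i => w (σ i)) := by
  have h : TensorAlgebra.equivDirectSum (TensorAlgebra.tprod K W n w) =
      DirectSum.lof K ℕ (fun n => ⨂[K]^n W) n (PiTensorProduct.tprod K w) :=
    TensorAlgebra.toDirectSum_tensorPower_tprod w
  simp only [act, LinearMap.comp_apply, AlgEquiv.toLinearMap_apply]
  rw [h, DirectSum.toModule_lof]
  simp only [LinearMap.sum_apply, LinearMap.smul_apply, LinearMap.comp_apply,
    LinearEquiv.coe_coe, PiTensorProduct.reindex_tprod, TensorPower.toTensorAlgebra_tprod,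
    Equiv.symm_symm]

/-- The free Lie algebra on `W`, as the Lie subalgebra of the tensor algebra (with the commutator
bracket) generated by `W`. -/
def freeLie (K : Type u) [Field K] (W : Type v) [AddCommGroup W] [Module K W] :
    LieSubalgebra K (TensorAlgebra K W) :=
  LieSubalgebra.lieSpan K (TensorAlgebra K W) (Set.range (TensorAlgebra.ι K))

/-- A Lie idempotent: a symmetrizer that projects the tensor algebra of every `K`-vector space onto
the free Lie algebra on that space. -/
def Symmetrizer.IsLieIdempotent (a : Symmetrizer K) : Prop :=
  ∀ (W : Type u) [AddCommGroup W] [Module K W],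
    LinearMap.IsProj (freeLie K W).toSubmodule (a.act W)

end LieIdempotent

/-!
A self-avoiding hike is determined by the set of its simple cycles, which are pairwise
vertex-disjoint and hence commute (`Hike.IsSelfAvoiding.eq_of_factors_eq`). Two facts follow.

First, `K⟨S_G⟩` is commutative (`HikeAlgebra.commute_all`). Permuting the factors of a tensor does
not change its image in `K⟨S_G⟩`, so a symmetrizer `a` induces on it the operator that multiplies a
hike `h` with `Ω(h) = n` by the sum of the coefficients of `a n`. For a Lie idempotent this sum is
`1` if `n = 1` and `0` otherwise: this is read off its action on the tensor algebra of the line `K`,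
which is `K[X]`, where the free Lie algebra is `K X` (`Symmetrizer.IsLieIdempotent.sum_coeff`). The
endomorphism induced by a Lie idempotent therefore fixes the simple cycles and kills all other
self-avoiding hikes. It is unique because the simple cycles generate the algebra `K⟨S_G⟩`
(`HikeAlgebra.ofTensor_surjective`).

Secondly, the splittings of `h` into two vertex-disjoint hikes correspond to the subsets of its
simple cycles (`SelfAvoidingHike.sum_divisors`). Write `expDiag P` for the operator that multiplies
`h` by the coefficient of `Xⁿ / n!` in the power series `P`, where `n = Ω(h)`. Then
`expDiag P ⋆ expDiag Q = expDiag (P * Q)` (`HikeAlgebra.convolve_expDiag`). The operators `ηε`, `id`,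
`S` and `E` are those of `1`, `exp X`, `exp (-X)` and `X exp X`, so the Eulerian and the Dynkin
idempotents are those of `log (exp X) = X` and `exp (-X) * X exp X = X`. As `expDiag X` is the
operator that keeps the simple cycles and kills the other hikes, all the idempotents coincide.
-/

/-! ### Self-avoiding hikes as sets of simple cycles -/

namespace Hike

variable {V : Type v} {G : Digraph V}

/-- The multiset of simple cycles composing a hike, as a monoid homomorphism. -/
def factorsHom (G : Digraph V) : Hike G →* Multiplicative (Multiset (SimpleCycle G)) :=
  PresentedMonoid.lift (fun p => Multiplicative.ofAdd {p}) (by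
    rintro _ _ ⟨p, q, _⟩
    simp [mul_comm])

/-- The multiset of simple cycles composing a hike. -/
def factors (h : Hike G) : Multiset (SimpleCycle G) := (factorsHom G h).toAdd

@[simp] theorem factors_one : (1 : Hike G).factors = 0 := by simp [factors]

@[simp] theorem factors_mul (h k : Hike G) : (h * k).factors = h.factors + k.factors := by
  simp [factors]

@[simp] theorem factors_ofCycle (p : SimpleCycle G) : (ofCycle p).factors = {p} := rfl

/-- The hike composed of a list of simple cycles, in this order. -/
def ofList (l : List (SimpleCycle G)) : Hike G := (l.map ofCycle).prod

theorem exists_ofList (h : Hike G) : ∃ l, ofList l = h := by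
  induction h using PresentedMonoid.inductionOn with | _ w
  refine ⟨FreeMonoid.toList w, ?_⟩
  induction w using FreeMonoid.inductionOn' with
  | one => rfl
  | of_mul p w ih => simpa [ofList, ofCycle, PresentedMonoid.of] using congrArg (ofCycle p * ·) ih

@[simp] theorem factors_ofList (l : List (SimpleCycle G)) : (ofList l).factors = l := by
  induction l with
  | nil => simp [ofList]
  | cons p l ih =>
    rw [ofList, List.map_cons, List.prod_cons, factors_mul, ← ofList, ih]
    rfl

theorem verts_eq_sum (h : Hike G) : h.verts = (h.factors.map SimpleCycle.verts).sum := by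
  obtain ⟨l, rfl⟩ := exists_ofList h
  rw [factors_ofList]
  induction l with
  | nil => simp [ofList]
  | cons p l ih => simpa [ofList] using ih

theorem omega_eq_card (h : Hike G) : h.omega = h.factors.card := by
  obtain ⟨l, rfl⟩ := exists_ofList h
  rw [factors_ofList]
  induction l with
  | nil => simp [ofList, omega]
  | cons p l ih =>
    have hp : ∀ k : Hike G, (ofCycle p * k).omega = 1 + k.omega := fun k => by
      rw [omega, map_mul]; rfl
    simpa [ofList, hp, add_comm] using ih

theorem commute_ofCycle {p q : SimpleCycle G} (h : Disjoint p.verts q.verts) :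
    Commute (ofCycle p) (ofCycle q) :=
  (Con.eq _).2 (ConGen.Rel.of _ _ (HikeRel.comm p q h))

theorem pairwise_of_isSelfAvoiding_ofList {l : List (SimpleCycle G)}
    (hl : (ofList l).IsSelfAvoiding) :
    l.Pairwise (fun p q => Disjoint p.verts q.verts) := by
  induction l with
  | nil => exact List.Pairwise.nil
  | cons p l ih =>
    rw [IsSelfAvoiding, verts_eq_sum, factors_ofList] at hl
    simp only [Multiset.map_coe, List.map_cons, Multiset.sum_coe, List.sum_cons,
      Multiset.nodup_add] at hl
    refine List.pairwise_cons.2 ⟨fun q hq => hl.2.2.mono_right ?_, ih ?_⟩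
    · have : q.verts ≤ ((l : Multiset (SimpleCycle G)).map SimpleCycle.verts).sum :=
        Multiset.le_sum_of_mem (Multiset.mem_map_of_mem _ (Multiset.mem_coe.2 hq))
      simpa using this
    · rw [IsSelfAvoiding, verts_eq_sum, factors_ofList]
      simpa using hl.2.1

/-- The simple cycles of a self-avoiding hike commute pairwise, so that they determine it. -/
theorem IsSelfAvoiding.eq_of_factors_eq {h k : Hike G} (hh : h.IsSelfAvoiding)
    (e : h.factors = k.factors) : h = k := by
  obtain ⟨l, rfl⟩ := exists_ofList h
  obtain ⟨m, rfl⟩ := exists_ofList k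
  rw [factors_ofList, factors_ofList, Multiset.coe_eq_coe] at e
  refine (e.map _).prod_eq' (List.pairwise_map.2 ?_)
  exact (pairwise_of_isSelfAvoiding_ofList hh).imp commute_ofCycle

theorem IsSelfAvoiding.nodup_factors {h : Hike G} (hh : h.IsSelfAvoiding) : h.factors.Nodup := by
  obtain ⟨l, rfl⟩ := exists_ofList h
  rw [factors_ofList, Multiset.coe_nodup]
  refine (pairwise_of_isSelfAvoiding_ofList hh).imp fun {p q} hpq e => ?_
  subst e
  have := p.verts_pos
  rw [disjoint_self, Multiset.bot_eq_zero] at hpq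
  simp [hpq] at this

theorem ofCycle_injective : Function.Injective (ofCycle : SimpleCycle G → Hike G) := fun p q h => by
  simpa using congrArg factors h

theorem omega_eq_one_iff {h : Hike G} : h.omega = 1 ↔ ∃ p, h = ofCycle p := by
  refine ⟨fun e => ?_, ?_⟩
  · obtain ⟨l, rfl⟩ := exists_ofList h
    rw [omega_eq_card, factors_ofList, Multiset.coe_card, List.length_eq_one_iff] at e
    obtain ⟨p, rfl⟩ := e
    exact ⟨p, by simp [ofList]⟩
  · rintro ⟨p, rfl⟩
    rfl

theorem omega_eq_zero_iff {h : Hike G} : h.omega = 0 ↔ h = 1 := by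
  refine ⟨fun e => ?_, ?_⟩
  · obtain ⟨l, rfl⟩ := exists_ofList h
    rw [omega_eq_card, factors_ofList, Multiset.coe_card, List.length_eq_zero_iff] at e
    simp [e, ofList]
  · rintro rfl
    simp [omega_eq_card]

theorem omega_mul (h k : Hike G) : (h * k).omega = h.omega + k.omega := by
  simp [omega_eq_card]

theorem length_ofCycle (p : SimpleCycle G) : (ofCycle p).length = p.length := by
  rw [length, verts_ofCycle]
  obtain ⟨c, _⟩ := p
  induction c using Quotient.inductionOn' with | _ l
  rfl

end Hike

namespace SelfAvoidingHike

variable {V : Type v} {G : Digraph V}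

open scoped Classical in
/-- Splitting a self-avoiding hike into two vertex-disjoint hikes amounts to choosing a subset of
its simple cycles. -/
theorem sum_divisors [Finite V] {M : Type*} [AddCommMonoid M] (φ : ℕ → ℕ → M)
    (h : SelfAvoidingHike G) :
    (∑ de : SelfAvoidingHike G × SelfAvoidingHike G with
      de.1.VDisjoint de.2 ∧ de.1.1 * de.2.1 = h.1, φ de.1.1.omega de.2.1.omega) =
    ∑ ij ∈ Finset.HasAntidiagonal.antidiagonal h.1.omega, (h.1.omega.choose ij.1) • φ ij.1 ij.2 := by
  let F : Finset (SimpleCycle G) := ⟨h.1.factors, h.2.nodup_factors⟩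
  have hF : F.card = h.1.omega := (Hike.omega_eq_card _).symm
  have key : (∑ de : SelfAvoidingHike G × SelfAvoidingHike G with
      de.1.VDisjoint de.2 ∧ de.1.1 * de.2.1 = h.1, φ de.1.1.omega de.2.1.omega) =
      ∑ s ∈ F.powerset, φ s.card (F.card - s.card) := by
    refine Finset.sum_bij (fun de _ => ⟨de.1.1.factors, de.1.2.nodup_factors⟩) ?_ ?_ ?_ ?_
    · rintro ⟨d, e⟩ hde
      simp only [Finset.mem_filter, Finset.mem_univ, true_and] at hde
      rw [Finset.mem_powerset, ← Finset.val_le_iff]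
      change d.1.factors ≤ h.1.factors
      rw [← hde.2, Hike.factors_mul]
      exact Multiset.le_add_right _ _
    · rintro ⟨d, e⟩ hde ⟨d', e'⟩ hde' heq
      simp only [Finset.mem_filter, Finset.mem_univ, true_and] at hde hde'
      have h1 : d.1.factors = d'.1.factors := congrArg Finset.val heq
      have h2 : e.1.factors = e'.1.factors := by
        have := congrArg Hike.factors (hde.2.trans hde'.2.symm)
        rw [Hike.factors_mul, Hike.factors_mul, h1] at this
        exact add_left_cancel this
      exact Prod.ext (Subtype.ext (d.2.eq_of_factors_eq h1))
        (Subtype.ext (e.2.eq_of_factors_eq h2))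
    · intro s hs
      rw [Finset.mem_powerset] at hs
      have hmul : Hike.ofList s.toList * Hike.ofList (F \ s).toList = h.1 := by
        refine (h.2.eq_of_factors_eq ?_).symm
        rw [Hike.factors_mul, Hike.factors_ofList, Hike.factors_ofList, Finset.coe_toList,
          Finset.coe_toList, Finset.sdiff_val, add_tsub_cancel_of_le (Finset.val_le_iff.2 hs)]
      have hn := h.2
      rw [Hike.IsSelfAvoiding, ← hmul, Hike.verts_mul, Multiset.nodup_add] at hn
      refine ⟨(⟨_, hn.1⟩, ⟨_, hn.2.1⟩), ?_, ?_⟩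
      · simp only [Finset.mem_filter, Finset.mem_univ, true_and]
        exact ⟨hn.2.2, hmul⟩
      · exact Finset.val_injective (by simp)
    · rintro ⟨d, e⟩ hde
      simp only [Finset.mem_filter, Finset.mem_univ, true_and] at hde
      have h3 : (⟨d.1.factors, d.2.nodup_factors⟩ : Finset (SimpleCycle G)).card = d.1.omega :=
        (Hike.omega_eq_card _).symm
      rw [h3, hF, ← hde.2, Hike.omega_mul, Nat.add_sub_cancel_left]
  rw [key, Finset.sum_powerset_apply_card (fun j => φ j (F.card - j)), hF,
    Finset.Nat.sum_antidiagonal_eq_sum_range_succ_mk]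

end SelfAvoidingHike

namespace HikeAlgebra

open PowerSeries

variable (K : Type u) [Field K] {V : Type v} (G : Digraph V)

/-! ### Commutativity of `K⟨S_G⟩` -/

theorem commute_basis (h k : SelfAvoidingHike G) : Commute (basis K G h) (basis K G k) := by
  rw [commute_iff_eq, basis_mul_basis, basis_mul_basis, basisMul, basisMul]
  by_cases hk : h.VDisjoint k
  · rw [dif_pos hk, dif_pos (show k.VDisjoint h from hk.symm)]
    refine congrArg _ (Subtype.ext ((h.mul k hk).2.eq_of_factors_eq ?_))
    change (h.1 * k.1).factors = (k.1 * h.1).factors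
    rw [Hike.factors_mul, Hike.factors_mul, add_comm]
  · rw [dif_neg hk, dif_neg (fun H : k.VDisjoint h => hk H.symm)]

theorem commute_all (a b : HikeAlgebra K G) : Commute a b := by
  have h1 : ∀ h, mulLin K G (basis K G h) = (mulLin K G).flip (basis K G h) := fun h =>
    (basis K G).ext fun k => commute_basis K G h k
  have h2 : mulLin K G = (mulLin K G).flip := (basis K G).ext h1
  exact LinearMap.congr_fun₂ h2 a b

theorem basis_mul_basis_of_disjoint {h k : SelfAvoidingHike G} (hk : h.VDisjoint k) :
    basis K G h * basis K G k = basis K G (h.mul k hk) := by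
  rw [basis_mul_basis, basisMul, dif_pos hk]

/-! ### Diagonal endomorphisms and exponential generating functions -/

/-- The endomorphism of `K⟨S_G⟩` that multiplies every hike `h` by `c n`, where `n = Ω(h)` and
`∑ c n Xⁿ / n!` is the power series `P`. -/
noncomputable def expDiag (P : K⟦X⟧) : HikeAlgebra K G →ₗ[K] HikeAlgebra K G :=
  (basis K G).constr K fun h => ((h.1.omega.factorial : K) * coeff h.1.omega P) • basis K G h

variable {K}

@[simp] theorem expDiag_basis (P : K⟦X⟧) (h : SelfAvoidingHike G) :
    expDiag K G P (basis K G h) =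
      ((h.1.omega.factorial : K) * coeff h.1.omega P) • basis K G h := by
  simp [expDiag]

theorem expDiag_sub (P Q : K⟦X⟧) : expDiag K G (P - Q) = expDiag K G P - expDiag K G Q :=
  (basis K G).ext fun h => by
    rw [LinearMap.sub_apply]
    simp only [expDiag_basis, map_sub, mul_sub, sub_smul]

/-- The convolution of diagonal endomorphisms is the product of exponential generating functions. -/
theorem convolve_expDiag [Finite V] [CharZero K] (P Q : K⟦X⟧) :
    convolve (expDiag K G P) (expDiag K G Q) = expDiag K G (P * Q) := by
  classical
  refine (basis K G).ext fun h => ?_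
  have hz : ∀ n : ℕ, (n.factorial : K) ≠ 0 := fun n => Nat.cast_ne_zero.2 n.factorial_ne_zero
  simp only [convolve, comul, LinearMap.comp_apply, Module.Basis.constr_basis, map_sum,
    TensorProduct.map_tmul, LinearMap.mul'_apply, expDiag_basis]
  have h1 : ∀ de ∈ Finset.univ.filter (fun de : SelfAvoidingHike G × SelfAvoidingHike G =>
      de.1.VDisjoint de.2 ∧ de.1.1 * de.2.1 = h.1),
      (((de.1.1.omega.factorial : K) * coeff de.1.1.omega P) • basis K G de.1) *
        (((de.2.1.omega.factorial : K) * coeff de.2.1.omega Q) • basis K G de.2) =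
      (((de.1.1.omega.factorial : K) * coeff de.1.1.omega P) *
        ((de.2.1.omega.factorial : K) * coeff de.2.1.omega Q)) • basis K G h := by
    rintro ⟨d, e⟩ hde
    simp only [Finset.mem_filter, Finset.mem_univ, true_and] at hde
    rw [smul_mul_smul_comm, basis_mul_basis_of_disjoint K G hde.1]
    exact congrArg _ (congrArg _ (Subtype.ext hde.2))
  rw [Finset.sum_congr rfl h1, ← Finset.sum_smul,
    SelfAvoidingHike.sum_divisors (fun i j => ((i.factorial : K) * coeff i P) *
      ((j.factorial : K) * coeff j Q)) h, coeff_mul, Finset.mul_sum]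
  refine congrArg (· • _) (Finset.sum_congr rfl fun ij hij => ?_)
  rw [Finset.HasAntidiagonal.mem_antidiagonal] at hij
  rw [nsmul_eq_mul, ← hij, Nat.cast_add_choose]
  field_simp [hz]

theorem expDiag_one [Finite V] : expDiag K G 1 = unitCounit K G := by
  classical
  refine (basis K G).ext fun h => ?_
  rw [expDiag_basis, unitCounit, Module.Basis.constr_basis, coeff_one]
  by_cases e : h.1 = 1
  · rw [if_pos e, if_pos (Hike.omega_eq_zero_iff.2 e), Hike.omega_eq_zero_iff.2 e, one_def]
    simp only [Nat.factorial_zero, Nat.cast_one, mul_one, one_smul]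
    exact congrArg _ (Subtype.ext e)
  · rw [if_neg e, if_neg (fun H => e (Hike.omega_eq_zero_iff.1 H)), mul_zero, zero_smul]

section Identification

variable [CharZero K]

theorem expDiag_exp : expDiag K G (exp K) = LinearMap.id :=
  (basis K G).ext fun h => by
    have : (h.1.omega.factorial : K) ≠ 0 := Nat.cast_ne_zero.2 h.1.omega.factorial_ne_zero
    simp [coeff_exp, this]

theorem expDiag_exp_neg : expDiag K G (evalNegHom (exp K)) = antipode K G :=
  (basis K G).ext fun h => by
    have : (h.1.omega.factorial : K) ≠ 0 := Nat.cast_ne_zero.2 h.1.omega.factorial_ne_zero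
    rw [expDiag_basis, antipode, Module.Basis.constr_basis, evalNegHom, coeff_rescale, coeff_exp]
    congr 1
    simp
    field_simp

theorem expDiag_X_mul_exp : expDiag K G (X * exp K) = grading K G :=
  (basis K G).ext fun h => by
    rw [expDiag_basis, grading, Module.Basis.constr_basis]
    congr 1
    cases h.1.omega with
    | zero => simp
    | succ n =>
      have : (n.factorial : K) ≠ 0 := Nat.cast_ne_zero.2 n.factorial_ne_zero
      rw [coeff_succ_X_mul, coeff_exp, Nat.factorial_succ]
      simp
      field_simp

/-- Since `exp (-X) * (X * exp X) = X`. -/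
theorem dynkin_eq_expDiag [Finite V] : dynkin K G = expDiag K G X := by
  rw [dynkin, ← expDiag_exp_neg, ← expDiag_X_mul_exp, convolve_expDiag]
  congr 1
  rw [mul_left_comm, mul_comm (evalNegHom (exp K)), exp_mul_exp_neg_eq_one, mul_one]

theorem convPow_expDiag [Finite V] (P : K⟦X⟧) (k : ℕ) :
    convPow (expDiag K G P) k = expDiag K G (P ^ k) := by
  induction k with
  | zero => rw [convPow, pow_zero, expDiag_one]
  | succ k ih => rw [convPow, ih, convolve_expDiag, pow_succ]

theorem coeff_exp_sub_one_pow_eq_zero {n k : ℕ} (h : n < k) :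
    coeff n ((exp K - 1) ^ k) = 0 := by
  have hd : (X : K⟦X⟧) ∣ exp K - 1 := X_dvd_iff.2 (by simp)
  exact X_pow_dvd_iff.1 (pow_dvd_pow_of_dvd hd k) n h

/-- The expansion of `log (exp X) = X`, up to order `N`: the derivative of the truncated logarithm
is a geometric sum, equal to `1 - (1 - exp X) ^ N`. -/
theorem coeff_sum_log_exp {n N : ℕ} (h : n ≤ N) :
    ∑ k ∈ Finset.range N, ((-1 : K) ^ k / (k + 1 : K)) * coeff n ((exp K - 1) ^ (k + 1)) =
      coeff n (X : K⟦X⟧) := by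
  cases n with
  | zero =>
    rw [coeff_zero_X]
    exact Finset.sum_eq_zero fun k _ => by
      rw [coeff_exp_sub_one_pow_eq_zero k.succ_pos, mul_zero]
  | succ n =>
    set L : K⟦X⟧ := ∑ k ∈ Finset.range N, ((-1 : K) ^ k / (k + 1 : K)) • (exp K - 1) ^ (k + 1)
    have hL : derivative K L = 1 - (1 - exp K) ^ N := by
      have h1 : derivative K L = exp K * ∑ k ∈ Finset.range N, (1 - exp K) ^ k := by
        rw [map_sum, Finset.mul_sum]
        refine Finset.sum_congr rfl fun k _ => ?_
        have hk : (k + 1 : K) ≠ 0 := Nat.cast_add_one_ne_zero k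
        have h2 : (1 - exp K) ^ k = ((-1 : K) ^ k) • (exp K - 1) ^ k := by
          rw [← neg_sub, neg_pow, smul_eq_C_mul]
          simp
        rw [Derivation.map_smul, derivative_pow, map_sub, derivative_exp, derivative_one, sub_zero, h2,
          Nat.add_sub_cancel, smul_eq_C_mul, smul_eq_C_mul, ← map_natCast (C (R := K))]
        have h3 : C ((-1 : K) ^ k / (k + 1 : K)) * C ((k + 1 : ℕ) : K) = C ((-1 : K) ^ k) := by
          rw [← map_mul]
          congr 1
          push_cast
          field_simp
        linear_combination ((exp K - 1) ^ k * exp K) * h3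
      rw [h1]
      have := mul_neg_geom_sum (1 - exp K) N
      rwa [sub_sub_cancel] at this
    have h4 : coeff (n + 1) L * (n + 1) = coeff n (1 : K⟦X⟧) := by
      have h6 : (1 - exp K) ^ N = C ((-1 : K) ^ N) * (exp K - 1) ^ N := by
        rw [← neg_sub, neg_pow]
        simp
      rw [← coeff_derivative, hL, map_sub, h6, coeff_C_mul, coeff_exp_sub_one_pow_eq_zero h,
        mul_zero, sub_zero]
    have h5 : coeff (n + 1) L = coeff (n + 1) (X : K⟦X⟧) := by
      refine mul_right_cancel₀ (Nat.cast_add_one_ne_zero n : (n + 1 : K) ≠ 0) ?_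
      rw [h4, coeff_one, coeff_X]
      by_cases hn : n = 0 <;> simp [hn]
    rw [← h5, map_sum]
    exact Finset.sum_congr rfl fun k _ => by rw [coeff_smul, smul_eq_mul]

/-- Since `log (exp X) = X`. -/
theorem eulerian_eq_expDiag [Finite V] : eulerian K G = expDiag K G X := by
  refine (basis K G).ext fun h => ?_
  rw [eulerian, Module.Basis.constr_basis, ← expDiag_exp, ← expDiag_one, ← expDiag_sub]
  simp only [convPow_expDiag, expDiag_basis]
  -- The terms with `Ω(h) ≤ k` vanish at `h`, because `X` divides `exp X - 1`.
  rw [finsum_eq_sum_of_support_subset (s := Finset.range h.1.omega),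
    ← coeff_sum_log_exp le_rfl, Finset.mul_sum, Finset.sum_smul]
  · refine Finset.sum_congr rfl fun k _ => ?_
    rw [smul_smul, mul_left_comm]
  · intro k hk
    rw [Finset.coe_range, Set.mem_Iio]
    by_contra hlt
    refine hk ?_
    dsimp only
    rw [coeff_exp_sub_one_pow_eq_zero (by omega), mul_zero, zero_smul, smul_zero]

end Identification

/-! ### The projection onto the simple cycles -/

theorem mem_of_basis_mem {N : Submodule K (HikeAlgebra K G)} (hN : ∀ h, basis K G h ∈ N)
    (a : HikeAlgebra K G) : a ∈ N := by
  have : Submodule.span K (Set.range (basis K G)) ≤ N :=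
    Submodule.span_le.2 (by rintro _ ⟨h, rfl⟩; exact hN h)
  exact this ((basis K G).mem_span a)

theorem expDiag_X_basis_of_ne {h : SelfAvoidingHike G} (hh : h.1.omega ≠ 1) :
    expDiag K G X (basis K G h) = 0 := by
  rw [expDiag_basis, coeff_X, if_neg hh, mul_zero, zero_smul]

theorem expDiag_X_prime (p : SimpleCycle G) : expDiag K G X (prime K G p) = prime K G p := by
  rw [prime, expDiag_basis]
  change ((Nat.factorial 1 : K) * coeff 1 X) • _ = _
  simp

theorem expDiag_X_of_mem {a : HikeAlgebra K G} (ha : a ∈ primeSpan K G) :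
    expDiag K G X a = a := by
  induction ha using Submodule.span_induction with
  | mem a ha =>
    obtain ⟨p, rfl⟩ := ha
    exact expDiag_X_prime G p
  | zero => exact map_zero _
  | add a b _ _ ha hb => rw [map_add, ha, hb]
  | smul r a _ ha => rw [map_smul, ha]

theorem expDiag_X_basis (h : SelfAvoidingHike G) :
    expDiag K G X (basis K G h) = 0 ∨
      ∃ p, h = SelfAvoidingHike.ofCycle p ∧ expDiag K G X (basis K G h) = prime K G p := by
  by_cases hh : h.1.omega = 1
  · obtain ⟨p, hp⟩ := Hike.omega_eq_one_iff.1 hh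
    obtain rfl : h = SelfAvoidingHike.ofCycle p := Subtype.ext hp
    exact Or.inr ⟨p, rfl, expDiag_X_prime G p⟩
  · exact Or.inl (expDiag_X_basis_of_ne G hh)

theorem ofCycle_injective :
    Function.Injective (SelfAvoidingHike.ofCycle : SimpleCycle G → SelfAvoidingHike G) :=
  fun _ _ h => Hike.ofCycle_injective (congrArg Subtype.val h)

theorem expDiag_X_sum [Finite V] :
    expDiag K G X (∑ h : SelfAvoidingHike G, basis K G h) = ∑ p : SimpleCycle G, prime K G p := by
  classical
  rw [map_sum, ← Finset.sum_subset
    (Finset.subset_univ (Finset.univ.image (SelfAvoidingHike.ofCycle (G := G)))),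
    Finset.sum_image (ofCycle_injective G).injOn]
  · exact Finset.sum_congr rfl fun p _ => expDiag_X_prime G p
  · intro h _ hh
    obtain e | ⟨p, rfl, _⟩ := expDiag_X_basis (K := K) G h
    · exact e
    · exact absurd (Finset.mem_image_of_mem _ (Finset.mem_univ p)) hh

theorem projectsOntoPrimes_expDiag_X [Finite V] : ProjectsOntoPrimes (expDiag K G X) where
  map_hike h := (expDiag_X_basis G h).imp_right fun ⟨p, _, hp⟩ => ⟨p, hp⟩
  isProj :=
    { map_mem := fun a => by
        change a ∈ (primeSpan K G).comap (expDiag K G X)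
        refine mem_of_basis_mem G (fun h => ?_) a
        rw [Submodule.mem_comap]
        obtain e | ⟨p, _, e⟩ := expDiag_X_basis (K := K) G h
        · rw [e]; exact zero_mem _
        · rw [e]; exact Submodule.subset_span ⟨p, rfl⟩
      map_id := fun a ha => expDiag_X_of_mem G ha }
  map_sum := expDiag_X_sum G
  count n := by
    classical
    rw [expDiag_X_sum, map_sum]
    simp only [Finsupp.coe_finsetSum, Finset.sum_apply, prime, Module.Basis.repr_self]
    rw [Finset.sum_comm, Fintype.card_subtype, Finset.card_filter, Nat.cast_sum]
    refine Finset.sum_congr rfl fun p _ => ?_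
    simp only [Finsupp.single_apply, Finset.sum_ite_eq, Finset.mem_filter, Finset.mem_univ,
      true_and]
    have : (SelfAvoidingHike.ofCycle p).1.length = p.length := Hike.length_ofCycle p
    rw [this]
    split_ifs <;> simp

/-! ### Products of simple cycles -/

/-- The span of the self-avoiding hikes composed of `n` simple cycles. -/
noncomputable def graded (K : Type u) [Field K] (n : ℕ) : Submodule K (HikeAlgebra K G) :=
  Submodule.span K (basis K G '' {h | h.1.omega = n})

theorem mul_mem_graded {m n : ℕ} {a b : HikeAlgebra K G} (ha : a ∈ graded G K m)
    (hb : b ∈ graded G K n) : a * b ∈ graded G K (m + n) := by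
  refine Submodule.span_induction₂ (p := fun a b _ _ => a * b ∈ graded G K (m + n))
    ?_ ?_ ?_ ?_ ?_ ?_ ?_ ha hb
  · rintro _ _ ⟨h, hh, rfl⟩ ⟨k, hk, rfl⟩
    rw [basis_mul_basis, basisMul]
    split_ifs with hd
    · refine Submodule.subset_span ⟨_, ?_, rfl⟩
      change (h.1 * k.1).omega = m + n
      rw [Hike.omega_mul, hh, hk]
    · exact zero_mem _
  · intro b _; rw [zero_mul]; exact zero_mem _
  · intro a _; rw [mul_zero]; exact zero_mem _
  · intro a b c _ _ _ h1 h2; rw [add_mul]; exact add_mem h1 h2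
  · intro a b c _ _ _ h1 h2; rw [mul_add]; exact add_mem h1 h2
  · intro r a b _ _ h1; rw [smul_mul_assoc]; exact Submodule.smul_mem _ _ h1
  · intro r a b _ _ h1; rw [mul_smul_comm]; exact Submodule.smul_mem _ _ h1

theorem primeSpan_le_graded : primeSpan K G ≤ graded G K 1 :=
  Submodule.span_mono (by rintro _ ⟨p, rfl⟩; exact ⟨_, rfl, rfl⟩)

theorem list_prod_mem_graded (l : List (HikeAlgebra K G)) (hl : ∀ a ∈ l, a ∈ primeSpan K G) :
    l.prod ∈ graded G K l.length := by
  induction l with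
  | nil =>
    exact Submodule.subset_span ⟨SelfAvoidingHike.one, Hike.omega_eq_zero_iff.2 rfl, rfl⟩
  | cons a l ih =>
    rw [List.prod_cons, List.length_cons, add_comm]
    exact mul_mem_graded G (primeSpan_le_graded G (hl a (by simp)))
      (ih fun b hb => hl b (by simp [hb]))

theorem expDiag_X_of_mem_graded {n : ℕ} {a : HikeAlgebra K G} (ha : a ∈ graded G K n) :
    expDiag K G X a = (if n = 1 then (1 : K) else 0) • a := by
  induction ha using Submodule.span_induction with
  | mem a ha =>
    obtain ⟨h, hh, rfl⟩ := ha
    rw [expDiag_basis, coeff_X, show h.1.omega = n from hh]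
    by_cases hn : n = 1 <;> simp [hn]
  | zero => rw [map_zero, smul_zero]
  | add a b _ _ ha hb => rw [map_add, ha, hb, smul_add]
  | smul r a _ ha => rw [map_smul, ha, smul_comm]

theorem linearCombination_prime_mem (w : SimpleCycle G →₀ K) :
    Finsupp.linearCombination K (prime K G) w ∈ primeSpan K G := by
  rw [primeSpan, ← Finsupp.range_linearCombination]
  exact LinearMap.mem_range_self _ w

theorem ofTensor_tprod (n : ℕ) (w : Fin n → SimpleCycle G →₀ K) :
    ofTensor K G (TensorAlgebra.tprod K _ n w) =
      (List.ofFn fun i => Finsupp.linearCombination K (prime K G) (w i)).prod := by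
  rw [TensorAlgebra.tprod_apply, map_list_prod, List.map_ofFn]
  simp [ofTensor, Function.comp_def]

theorem basis_mem_range_ofTensor (l : List (SimpleCycle G)) (hl : (Hike.ofList l).IsSelfAvoiding) :
    basis K G ⟨Hike.ofList l, hl⟩ ∈ (ofTensor K G).range := by
  induction l with
  | nil => exact one_mem _
  | cons p l ih =>
    have e : Hike.ofList (p :: l) = Hike.ofCycle p * Hike.ofList l := by simp [Hike.ofList]
    have hn := hl
    rw [Hike.IsSelfAvoiding, e, Hike.verts_mul, Multiset.nodup_add] at hn
    have h1 : basis K G ⟨Hike.ofList (p :: l), hl⟩ =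
        prime K G p * basis K G ⟨Hike.ofList l, hn.2.1⟩ := by
      rw [prime, basis_mul_basis_of_disjoint K G
        (h := SelfAvoidingHike.ofCycle p) (k := ⟨Hike.ofList l, hn.2.1⟩) hn.2.2]
      exact congrArg _ (Subtype.ext e)
    rw [h1]
    refine mul_mem ⟨TensorAlgebra.ι K (Finsupp.single p 1), ?_⟩ (ih hn.2.1)
    simp [ofTensor]

theorem ofTensor_surjective : Function.Surjective (ofTensor K G) := by
  intro a
  refine mem_of_basis_mem (N := LinearMap.range (ofTensor K G).toLinearMap) G (fun h => ?_) a
  obtain ⟨h, hh⟩ := h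
  obtain ⟨l, rfl⟩ := Hike.exists_ofList h
  exact basis_mem_range_ofTensor G l hh

end HikeAlgebra

/-! ### Lie idempotents -/

theorem TensorAlgebra.linearMap_ext_tprod {R M N : Type*} [CommRing R] [AddCommGroup M]
    [Module R M] [AddCommGroup N] [Module R N] {f g : TensorAlgebra R M →ₗ[R] N}
    (h : ∀ (n : ℕ) (w : Fin n → M), f (tprod R M n w) = g (tprod R M n w)) : f = g := by
  have key : f ∘ₗ (equivDirectSum (R := R) (M := M)).symm.toLinearMap =
      g ∘ₗ (equivDirectSum (R := R) (M := M)).symm.toLinearMap := by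
    refine DirectSum.linearMap_ext R fun n => PiTensorProduct.ext (MultilinearMap.ext fun w => ?_)
    have e : (equivDirectSum (R := R) (M := M)).symm
        (DirectSum.lof R ℕ (fun n => ⨂[R]^n M) n (PiTensorProduct.tprod R w)) = tprod R M n w :=
      ofDirectSum_of_tprod w
    simpa [e] using h n w
  ext1 t
  simpa using LinearMap.congr_fun key (equivDirectSum t)

section LieIdempotent

attribute [local instance] LieRing.ofAssociativeRing

open Polynomial in
/-- On the line `K`, the tensor algebra is `K[X]` and the free Lie algebra is `K X`; the symmetric
group acts trivially on each tensor power, so that a Lie idempotent acts on `Xⁿ` by the sum of its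
coefficients. -/
theorem Symmetrizer.IsLieIdempotent.sum_coeff {K : Type u} [Field K] {a : Symmetrizer K}
    (ha : a.IsLieIdempotent) (n : ℕ) :
    ∑ σ : Equiv.Perm (Fin n), (a n).coeff σ = if n = 1 then 1 else 0 := by
  -- The canonical isomorphism `T(K) ≅ K[X]`, of which only the direct map is needed.
  let φ : TensorAlgebra K K →ₐ[K] K[X] := TensorAlgebra.lift K (LinearMap.toSpanSingleton K K[X] X)
  have hφ : ∀ r, φ (TensorAlgebra.ι K r) = r • X := fun r => by simp [φ]
  let L : LieSubalgebra K (TensorAlgebra K K) :=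
    { (Submodule.span K {(X : K[X])}).comap φ.toLinearMap with
      lie_mem' := fun {x y} _ _ => by
        change φ ⁅x, y⁆ ∈ Submodule.span K {(X : K[X])}
        rw [LieRing.of_associative_ring_bracket, map_sub, map_mul, map_mul, mul_comm, sub_self]
        exact zero_mem _ }
  have hL : freeLie K K ≤ L := by
    refine LieSubalgebra.lieSpan_le.2 ?_
    rintro _ ⟨r, rfl⟩
    change φ _ ∈ Submodule.span K {(X : K[X])}
    rw [hφ]
    exact Submodule.smul_mem _ _ (Submodule.mem_span_singleton_self _)
  have hact : φ (a.act K (TensorAlgebra.tprod K K n fun _ => 1)) =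
      (∑ σ : Equiv.Perm (Fin n), (a n).coeff σ) • X ^ n := by
    rw [Symmetrizer.act_tprod, ← Finset.sum_smul, map_smul, TensorAlgebra.tprod_apply,
      List.ofFn_const, List.prod_replicate, map_pow, hφ, one_smul]
  -- The image of `Xⁿ` has degree `n` and lies on the line `K X`.
  obtain ⟨r, hr⟩ := Submodule.mem_span_singleton.1
    (hL ((ha K).map_mem (TensorAlgebra.tprod K K n fun _ => 1)))
  split_ifs with hn
  · subst hn
    have hι : (TensorAlgebra.tprod K K 1 fun _ => 1) = TensorAlgebra.ι K 1 := by
      simp [TensorAlgebra.tprod_apply]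
    rw [hι, (ha K).map_id _ (LieSubalgebra.subset_lieSpan ⟨1, rfl⟩), hφ] at hact
    have := congrArg (fun p => coeff p 1) hact
    simpa using this.symm
  · have := congrArg (fun p => coeff p n) (hr.trans hact)
    simpa [coeff_X, Ne.symm hn] using this.symm

end LieIdempotent

namespace HikeAlgebra

variable {K : Type u} [Field K] {V : Type v} (G : Digraph V)

open PowerSeries in
/-- As `K⟨S_G⟩` is commutative, permuting the factors of a tensor does not change its image, so that
a symmetrizer acts on products of `n` simple cycles by the sum of its coefficients of degree `n`. -/
theorem expDiag_X_ofTensor {a : Symmetrizer K} (ha : a.IsLieIdempotent)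
    (t : TensorAlgebra K (SimpleCycle G →₀ K)) :
    expDiag K G X (ofTensor K G t) = ofTensor K G (a.act (SimpleCycle G →₀ K) t) := by
  have key : expDiag K G X ∘ₗ (ofTensor K G).toLinearMap =
      (ofTensor K G).toLinearMap ∘ₗ a.act (SimpleCycle G →₀ K) := by
    refine TensorAlgebra.linearMap_ext_tprod fun n w => ?_
    simp only [LinearMap.comp_apply, AlgHom.toLinearMap_apply]
    rw [Symmetrizer.act_tprod, map_sum]
    have hperm : ∀ σ : Equiv.Perm (Fin n),
        ofTensor K G (TensorAlgebra.tprod K _ n fun i => w (σ i)) =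
          ofTensor K G (TensorAlgebra.tprod K _ n w) := fun σ => by
      rw [ofTensor_tprod, ofTensor_tprod]
      exact (σ.ofFn_comp_perm
        fun i => Finsupp.linearCombination K (prime K G) (w i)).prod_eq'
          (List.pairwise_of_forall fun _ _ => commute_all K G _ _)
    simp only [map_smul, hperm]
    rw [← Finset.sum_smul, ha.sum_coeff, ofTensor_tprod]
    refine expDiag_X_of_mem_graded G ?_
    have := list_prod_mem_graded G
      (List.ofFn fun i => Finsupp.linearCombination K (prime K G) (w i))
      (fun b hb => by
        obtain ⟨i, rfl⟩ := (List.mem_ofFn' _ _).1 hb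
        exact linearCombination_prime_mem G (w i))
    rwa [List.length_ofFn] at this
  exact LinearMap.congr_fun key t

end HikeAlgebra

theorem mainTheorem4 {K : Type u} [Field K] [CharZero K] {V : Type v} [Finite V] (G : Digraph V) :
    (∀ a : Symmetrizer K, a.IsLieIdempotent →
      ∃ f : HikeAlgebra K G →ₗ[K] HikeAlgebra K G,
        (∀ g : HikeAlgebra K G →ₗ[K] HikeAlgebra K G,
          (∀ t : TensorAlgebra K (SimpleCycle G →₀ K),
            g (HikeAlgebra.ofTensor K G t) =
              HikeAlgebra.ofTensor K G (a.act (SimpleCycle G →₀ K) t)) ↔ g = f) ∧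
        HikeAlgebra.ProjectsOntoPrimes f) ∧
    HikeAlgebra.ProjectsOntoPrimes (HikeAlgebra.eulerian K G) ∧
    HikeAlgebra.ProjectsOntoPrimes (HikeAlgebra.dynkin K G) := by
  refine ⟨fun a ha => ⟨HikeAlgebra.expDiag K G PowerSeries.X, fun g => ⟨fun hg => ?_, ?_⟩,
    HikeAlgebra.projectsOntoPrimes_expDiag_X G⟩, ?_, ?_⟩
  · refine LinearMap.ext fun x => ?_
    obtain ⟨t, rfl⟩ := HikeAlgebra.ofTensor_surjective G x
    rw [hg, HikeAlgebra.expDiag_X_ofTensor G ha]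
  · rintro rfl t
    exact HikeAlgebra.expDiag_X_ofTensor G ha t
  · rw [HikeAlgebra.eulerian_eq_expDiag]
    exact HikeAlgebra.projectsOntoPrimes_expDiag_X G
  · rw [HikeAlgebra.dynkin_eq_expDiag]
    exact HikeAlgebra.projectsOntoPrimes_expDiag_X G
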